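/- **Setting.** Let $K\ge 2$ and let $\nu=(\nu_1,\dots,\nu_K)$ be $1$-sub-Gaussian probability distributions on $\mathbb{R}$ (that is, $\mathbb{E}_{X\sim\nu_i}[e^{\lambda(X-\mathbb{E}X)}]\le e^{\lambda^2/2}$ for all $\lambda\in\mathbb{R}$) with means $\mu_1,\dots,\mu_K$. Put $\mu_\star=\max_i\mu_i$, $\Delta_i=\mu_\star-\mu_i$, $\Delta_{\max}=\max_i\Delta_i$ and, if the means are not all equal, $\Delta_{\min}=\min\{\Delta_i : \Delta_i>0\}$. At each round $n=1,2,\dots$ an arm $I_n$ is chosen from the past information, and a reward $X_n$ is observed whose conditional law given that information is $\nu_{I_n}$. Let $N_{n,i}=\sum_{t<n}\mathbf 1\{I_t=i\}$ and $\mu_{n,i}=N_{n,i}^{-1}\sum_{t<n}X_t\mathbf 1\{I_t=i\}$. **Algorithm EB-TC$_{\varepsilon_0}$ with slack $\varepsilon_0>0$ and fixed proportion $\beta=1/2$.** Each arm is pulled once in the first $K$ rounds. At each round $n>K$, let (ties being broken arbitrarily) $$B_n=\hat\imath_n\in\arg\max_i\mu_{n,i},\qquad C_n\in\arg\min_{i\ne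 B_n}\frac{\mu_{n,B_n}-\mu_{n,i}+\varepsilon_0}{\sqrt{1/N_{n,B_n}+1/N_{n,i}}}.$$ Let $T_n(i,j)$ be the number of rounds $K<t<n$ with $(B_t,C_t)=(i,j)$, and $N^i_{n,j}$ the number of those rounds at which also $I_t=j$. Pull $I_n=C_n$ if $N^{B_n}_{n,C_n}\le(1-\beta)\,T_{n+1}(B_n,C_n)$, where $T_{n+1}(B_n,C_n)=T_n(B_n,C_n)+1$, and $I_n=B_n$ otherwise. The recommendation at round $n$ is $\hat\imath_n$. **Statement.** An agent that pulls $\hat\imath_n$ at each round $n>K$ has constant cumulative regret: 1. For all $K\ge2$, $\varepsilon_0>0$ and $\nu$ as above there is a constant $R$, which depends only on $(K,\varepsilon_0,\nu)$, such that $$\sum_{n=K+1}^{T}\mathbb{E}_\nu[\mu_\star-\mu_{\hat\imath_n}]\le R\qquad\text{for all } T>K.$$ 2. For every $\kappa>1$ there is a constant $c>0$, which depends only on $\kappa$, such that for all $K\ge 2$, all $\varepsilon_0>0$ and all $\nu$ as above whose means are not all equal and which satisfy $K/\min\{\Delta_{\min},\varepsilon_0\}^2\ge\kappa$, $$\sum_{n=K+1}^{T}\mathbb{E}_\nu[\mu_\star-\mu_{\hat\imath_n}]\le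 c\cdot\frac{K^3\Delta_{\max}}{\min\{\Delta_{\min},\varepsilon_0\}^2}\left(\log\frac{K}{\min\{\Delta_{\min},\varepsilon_0\}^2}\right)^2\qquad\text{for all } T>K.$$ -/

import Mathlib

open MeasureTheory ProbabilityTheory

namespace EBTC

noncomputable section

/-- A probability distribution on the real line is `1`-sub-Gaussian:
`E[exp (t (X - E[X]))] ≤ exp (t ^ 2 / 2)` for all real `t` (with these expectations finite). -/
def IsOneSubGaussian (ρ : Measure ℝ) : Prop :=
  HasSubgaussianMGF (fun x : ℝ => x - ∫ y, y ∂ρ) 1 ρ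

section Instance

variable {K : ℕ}

/-- Mean of arm `i`. -/
def armMean (ν : Fin K → Measure ℝ) (i : Fin K) : ℝ := ∫ x, x ∂(ν i)

/-- Largest mean. -/
def bestMean (ν : Fin K → Measure ℝ) : ℝ := ⨆ i, armMean ν i

/-- Sub-optimality gap of arm `i`. -/
def gap (ν : Fin K → Measure ℝ) (i : Fin K) : ℝ := bestMean ν - armMean ν i

/-- Largest gap. -/
def maxGap (ν : Fin K → Measure ℝ) : ℝ := ⨆ i, gap ν i

/-- Smallest positive gap (meaningful when some arm is sub-optimal). -/
def minGap (ν : Fin K → Measure ℝ) : ℝ := sInf {x : ℝ | ∃ i, 0 < gap ν i ∧ x = gap ν i}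

end Instance

section Statistics

/-! Statistics of a trajectory. Rounds are numbered from `1`. `I t` is the arm pulled at round `t`,
`X t` the reward observed, `B t` and `C t` the leader and the challenger (used for `t > K`). -/

variable {K : ℕ}

/-- Number of pulls of arm `i` before round `n`. -/
def pulls (I : ℕ → Fin K) (n : ℕ) (i : Fin K) : ℕ :=
  ((Finset.Ico 1 n).filter (fun t => I t = i)).card

/-- Empirical mean of arm `i` before round `n`. -/
def empMean (I : ℕ → Fin K) (X : ℕ → ℝ) (n : ℕ) (i : Fin K) : ℝ :=
  (∑ t ∈ (Finset.Ico 1 n).filter (fun t => I t = i), X t) / (pulls I n i : ℝ)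

/-- Number of rounds before `n` (and after the `K` initial ones) at which the pair
(leader, challenger) was `(i, j)`. -/
def pairCount (B C : ℕ → Fin K) (n : ℕ) (i j : Fin K) : ℕ :=
  ((Finset.Ioo K n).filter (fun t => B t = i ∧ C t = j)).card

/-- Number of those rounds at which, moreover, the challenger `j` was pulled. -/
def pairChallengerPulls (I B C : ℕ → Fin K) (n : ℕ) (i j : Fin K) : ℕ :=
  ((Finset.Ioo K n).filter (fun t => B t = i ∧ C t = j ∧ I t = j)).card

/-- Empirical transportation cost, with slack `ε₀`, of the leader `i` against the arm `j`. -/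
def transportCost (ε₀ : ℝ) (I : ℕ → Fin K) (X : ℕ → ℝ) (n : ℕ) (i j : Fin K) : ℝ :=
  (empMean I X n i - empMean I X n j + ε₀) /
    Real.sqrt (1 / (pulls I n i : ℝ) + 1 / (pulls I n j : ℝ))

/-- The trajectory follows the algorithm `EB-TC` with slack `ε₀` and fixed proportion `β`.
The leader `B n` is also the recommendation at round `n`. Ties are broken arbitrarily, and each arm
is pulled once, in an arbitrary order, during the first `K` rounds. -/
structure FollowsEBTC (ε₀ β : ℝ) (I : ℕ → Fin K) (X : ℕ → ℝ) (B C : ℕ → Fin K) : Prop where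
  init : ∀ i, pulls I (K + 1) i = 1
  leader : ∀ n, K < n → ∀ i, empMean I X n i ≤ empMean I X n (B n)
  challenger_ne : ∀ n, K < n → C n ≠ B n
  challenger : ∀ n, K < n → ∀ i, i ≠ B n →
    transportCost ε₀ I X n (B n) (C n) ≤ transportCost ε₀ I X n (B n) i
  tracking : ∀ n, K < n →
    I n = if (pairChallengerPulls I B C n (B n) (C n) : ℝ)
        ≤ (1 - β) * (pairCount B C (n + 1) (B n) (C n) : ℝ) then C n else B n

end Statistics

section Interaction

variable {K : ℕ} {Ω : Type*} {mΩ : MeasurableSpace Ω}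

/-- The random processes `I` (arms pulled), `X` (rewards), `B` (leaders, that is recommendations)
and `C` (challengers) come from running `EB-TC` with slack `ε₀` and fixed proportion `β` on the
bandit instance `ν`. The sigma-algebra `ℱ n` is the information available at round `n` before its
reward is drawn: it contains the past observations and may contain external randomness used to
break ties. Given `ℱ n`, the reward of round `n` has law `ν (I n)`. -/
structure IsEBTCRun (ε₀ β : ℝ) (ν : Fin K → Measure ℝ) (P : Measure Ω) (ℱ : Filtration ℕ mΩ)
    (I : ℕ → Ω → Fin K) (X : ℕ → Ω → ℝ) (B C : ℕ → Ω → Fin K) : Prop where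
  measurable_arm : ∀ n, 1 ≤ n → Measurable[ℱ n] (I n)
  measurable_reward : ∀ n, 1 ≤ n → Measurable[ℱ (n + 1)] (X n)
  measurable_leader : ∀ n, K < n → Measurable[ℱ n] (B n)
  measurable_challenger : ∀ n, K < n → Measurable[ℱ n] (C n)
  reward_law : ∀ n, 1 ≤ n → ∀ A : Set Ω, MeasurableSet[ℱ n] A → ∀ (i : Fin K) (s : Set ℝ),
    MeasurableSet s →
      P (A ∩ {ω | I n ω = i} ∩ {ω | X n ω ∈ s}) = P (A ∩ {ω | I n ω = i}) * ν i s
  follows : ∀ ω, FollowsEBTC ε₀ β (fun n => I n ω) (fun n => X n ω)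
    (fun n => B n ω) (fun n => C n ω)

/-- Cumulative regret, over the rounds `K + 1, …, T`, of the agent that pulls the recommended arm
`B n` at each round `n`. -/
def inducedRegret (ν : Fin K → Measure ℝ) (P : Measure Ω) (B : ℕ → Ω → Fin K) (T : ℕ) : ℝ :=
  ∑ n ∈ Finset.Icc (K + 1) T, ∫ ω, (bestMean ν - armMean ν (B n ω)) ∂P

end Interaction

end

end EBTC

/-!
Empirical means are compared with confidence radii that depend on an integer level `D`: an arm with
at least `D` pulls has to be `m / 4`-accurate, where `m = min Δ_min ε₀`, while the accuracy asked of
an arm with `N < D` pulls degrades like `√(D / N)`. On a trajectory that respects level `D`, a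
sub-optimal leader with more than `4 D` pulls forces the best arm to have fewer than `D` pulls, and
then the transportation cost of the best arm is at most `(5 / 4) ε₀ √D`. The challenger minimizes
this cost, and its own cost is at least `ε₀ √(2 D)` if it has more than `4 D` pulls as well. Hence
leader or challenger has at most `4 D` pulls, so by tracking their pair has been used `O(D)` times,
and there are `O(K² D)` rounds with a sub-optimal leader.

The probability that level `D` is violated decays exponentially in `D`: stop the exponential
supermartingale of an arm after `N` pulls and take a union bound over the arms and over `N`, which
costs no factor depending on the horizon because the radius at `N > D` does not decrease. Summing
over `D` bounds the expected number of rounds with a sub-optimal leader.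
-/

namespace EBTC

section Counting

open Finset

lemma card_filter_Ioo_succ (p : ℕ → Prop) [DecidablePred p] (k n : ℕ) :
    #{t ∈ Ioo k (n + 1) | p t} = #{t ∈ Ioo k n | p t} + if k < n ∧ p n then 1 else 0 := by
  by_cases hk : k < n
  · rw [Ioo_add_one_right_eq_Ioc, ← Ioo_insert_right hk, filter_insert]
    split_ifs <;> simp_all
  · have : Ioo k (n + 1) = Ioo k n := by ext; simp only [mem_Ioo]; omega
    simp [this, hk]

lemma card_le_card_mul_of_card_filter_lt_le {ι α : Type*} [LinearOrder ι] [Fintype α]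
    [DecidableEq α] (f : ι → α) {S : Finset ι} {q : ℕ}
    (hq : ∀ n ∈ S, #{t ∈ S | t < n ∧ f t = f n} ≤ q) : #S ≤ Fintype.card α * (q + 1) := by
  have card_fiber_le (a : α) : #{n ∈ S | f n = a} ≤ q + 1 := by
    rcases ({n ∈ S | f n = a} : Finset ι).eq_empty_or_nonempty with hempty | hne
    · simp [hempty]
    obtain ⟨hlastS, hlast⟩ := mem_filter.1 (max'_mem _ hne)
    refine (card_erase_add_one (max'_mem _ hne)).symm.le.trans
      (Nat.add_le_add_right ((card_le_card fun t ht => ?_).trans (hq _ hlastS)) 1)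
    obtain ⟨htS, hta⟩ := mem_filter.1 (mem_of_mem_erase ht)
    exact mem_filter.2 ⟨htS, lt_max'_of_mem_erase_max' _ hne ht, hta.trans hlast.symm⟩
  simpa [mul_comm] using card_le_mul_card_image_of_maps_to (t := univ) (f := f)
    (fun n _ => mem_univ (f n)) (q + 1) fun a _ => card_fiber_le a

lemma exists_not_le_add_card_filter {p : ℕ → Prop} [DecidablePred p] {a T : ℕ}
    (h : #{D ∈ Ico a (a + T) | p D} < T) :
    ∃ D ≤ a + #{D ∈ Ico a (a + T) | p D}, ¬ p D := by
  set c := #{D ∈ Ico a (a + T) | p D}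
  obtain ⟨D, hD, hDp⟩ : ∃ D ∈ Ico a (a + (c + 1)), D ∉ ({D ∈ Ico a (a + T) | p D} : Finset ℕ) :=
    exists_mem_notMem_of_card_lt_card (by simp [c])
  rw [mem_Ico] at hD
  exact ⟨D, by omega, fun hp => hDp (mem_filter.2 ⟨mem_Ico.2 (by omega), hp⟩)⟩

end Counting

section Exponentials

lemma sum_exp_neg_mul_le {b : ℝ} (hb : 0 < b) (s : Finset ℕ) :
    ∑ j ∈ s, Real.exp (-(b * j)) ≤ 1 + b⁻¹ := by
  have exp_lt_one : Real.exp (-b) < 1 := by simpa using hb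
  have exp_le : Real.exp (-b) ≤ 1 - (1 + b⁻¹)⁻¹ := by
    have : Real.exp (-b) ≤ (1 + b)⁻¹ := by
      rw [Real.exp_neg]
      exact inv_anti₀ (by positivity) (by linarith [Real.add_one_le_exp b])
    calc Real.exp (-b) ≤ (1 + b)⁻¹ := this
      _ = 1 - (1 + b⁻¹)⁻¹ := by field_simp; ring
  calc ∑ j ∈ s, Real.exp (-(b * j)) = ∑ j ∈ s, Real.exp (-b) ^ j := by
        refine Finset.sum_congr rfl fun j _ => ?_
        rw [← Real.exp_nat_mul, mul_neg, mul_comm]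
    _ ≤ (1 - Real.exp (-b))⁻¹ := by
        rw [← tsum_geometric_of_lt_one (Real.exp_nonneg _) exp_lt_one]
        exact (summable_geometric_of_lt_one (Real.exp_nonneg _) exp_lt_one).sum_le_tsum s
          fun _ _ => by positivity
    _ ≤ 1 + b⁻¹ := inv_le_of_inv_le₀ (by positivity) (by linarith)

lemma sum_Ico_exp_neg_mul_le {b : ℝ} (hb : 0 < b) (a T : ℕ) :
    ∑ j ∈ Finset.Ico a (a + T), Real.exp (-(b * j)) ≤ Real.exp (-(b * a)) * (1 + b⁻¹) := by
  calc ∑ j ∈ Finset.Ico a (a + T), Real.exp (-(b * j))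
      = Real.exp (-(b * a)) * ∑ j ∈ Finset.range T, Real.exp (-(b * j)) := by
        rw [Finset.sum_Ico_eq_sum_range, Nat.add_sub_cancel_left, Finset.mul_sum]
        refine Finset.sum_congr rfl fun j _ => ?_
        rw [← Real.exp_add]
        push_cast
        ring_nf
    _ ≤ Real.exp (-(b * a)) * (1 + b⁻¹) := by
        gcongr
        exact sum_exp_neg_mul_le hb _

end Exponentials

section Integration

variable {Ω : Type*} {mΩ : MeasurableSpace Ω} {P : Measure Ω}

lemma measureReal_le_exp_neg_of_lintegral_exp_le_one {Y : Ω → ℝ} (hY : Measurable Y)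
    (hexp : ∫⁻ ω, ENNReal.ofReal (Real.exp (Y ω)) ∂P ≤ 1) (a : ℝ) :
    P.real {ω | a ≤ Y ω} ≤ Real.exp (-a) := by
  refine ENNReal.toReal_le_of_le_ofReal (Real.exp_nonneg _) ?_
  calc P {ω | a ≤ Y ω}
      = P {ω | ENNReal.ofReal (Real.exp a) ≤ ENNReal.ofReal (Real.exp (Y ω))} := by
        simp only [ENNReal.ofReal_le_ofReal_iff (Real.exp_nonneg _), Real.exp_le_exp]
    _ ≤ (∫⁻ ω, ENNReal.ofReal (Real.exp (Y ω)) ∂P) / ENNReal.ofReal (Real.exp a) :=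
        meas_ge_le_lintegral_div (by fun_prop) (by simp [Real.exp_pos]) ENNReal.ofReal_ne_top
    _ ≤ 1 / ENNReal.ofReal (Real.exp a) := by gcongr
    _ = ENNReal.ofReal (Real.exp (-a)) := by
        rw [Real.exp_neg, ENNReal.ofReal_inv_of_pos (Real.exp_pos a), one_div]

lemma IsOneSubGaussian.lintegral_exp_le_one {ρ : Measure ℝ} (hρ : IsOneSubGaussian ρ) (l : ℝ) :
    ∫⁻ x, ENNReal.ofReal (Real.exp (l * (x - ∫ y, y ∂ρ) - l ^ 2 / 2)) ∂ρ ≤ 1 := by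
  have hint := (hρ.integrable_exp_mul l).div_const (Real.exp (l ^ 2 / 2))
  have hmgf : ∫ x, Real.exp (l * (x - ∫ y, y ∂ρ)) ∂ρ ≤ Real.exp (l ^ 2 / 2) := by
    simpa [mgf] using hρ.mgf_le l
  simp_rw [Real.exp_sub]
  rw [← ofReal_integral_eq_lintegral_ofReal hint (ae_of_all _ fun x => by positivity),
    integral_div]
  exact ENNReal.ofReal_le_one.2 (div_le_one_of_le₀ hmgf (Real.exp_nonneg _))

/- The events `F D` need not be measurable: they are replaced by their measurable hulls. Counting
the levels `D ≥ D₀` whose event occurs gives an upper bound on the first level whose event fails. -/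
open Classical in
lemma integral_le_of_le_off_levels [IsProbabilityMeasure P] {f : Ω → ℝ} {F : ℕ → Set Ω} {a b : ℝ}
    (ha : 0 ≤ a) (hb : 0 ≤ b) (T D₀ : ℕ) (hf : ∀ ω, 0 ≤ f ω) (hfT : ∀ ω, f ω ≤ a * T)
    (hF : ∀ D, ∀ ω ∉ F D, f ω ≤ a * D + b) :
    ∫ ω, f ω ∂P ≤ a * (D₀ + ∑ D ∈ Finset.Ico D₀ (D₀ + T), P.real (F D)) + b := by
  let G (D : ℕ) : Set Ω := toMeasurable P (F D)
  let occurring (ω : Ω) : Finset ℕ := {D ∈ Finset.Ico D₀ (D₀ + T) | ω ∈ G D}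
  have le_count (ω : Ω) : f ω ≤ a * (D₀ + (occurring ω).card) + b := by
    by_cases hcount : (occurring ω).card < T
    · obtain ⟨D, hD, hDG⟩ := exists_not_le_add_card_filter hcount
      calc f ω ≤ a * D + b := hF D ω fun hω => hDG (subset_toMeasurable P _ hω)
        _ ≤ a * (D₀ + (occurring ω).card) + b := by gcongr; exact_mod_cast hD
    · calc f ω ≤ a * T := hfT ω
        _ ≤ a * (D₀ + (occurring ω).card) := by gcongr; exact_mod_cast (by omega)
        _ ≤ a * (D₀ + (occurring ω).card) + b := le_add_of_nonneg_right hb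
  have count_eq (ω : Ω) : ((occurring ω).card : ℝ) =
      ∑ D ∈ Finset.Ico D₀ (D₀ + T), (G D).indicator 1 ω := by
    simp [occurring, Set.indicator_apply]
  have hG (D : ℕ) : Integrable ((G D).indicator (1 : Ω → ℝ)) P :=
    (integrable_const 1).indicator (measurableSet_toMeasurable P _)
  have hsum := integrable_finsetSum (Finset.Ico D₀ (D₀ + T)) fun D _ => hG D
  have hcount : Integrable
      (fun ω => (D₀ : ℝ) + ∑ D ∈ Finset.Ico D₀ (D₀ + T), (G D).indicator 1 ω) P :=
    (integrable_const _).add hsum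
  calc ∫ ω, f ω ∂P
      ≤ ∫ ω, (a * (D₀ + ∑ D ∈ Finset.Ico D₀ (D₀ + T), (G D).indicator 1 ω) + b) ∂P :=
        integral_mono_of_nonneg (ae_of_all _ hf) ((hcount.const_mul a).add (integrable_const b))
          (ae_of_all _ fun ω => (le_count ω).trans_eq (by rw [count_eq]))
    _ = a * (D₀ + ∑ D ∈ Finset.Ico D₀ (D₀ + T), P.real (F D)) + b := by
        rw [integral_add (hcount.const_mul a) (integrable_const b),
          integral_const_mul, integral_add (integrable_const _) hsum,
          integral_finsetSum _ fun D _ => hG D]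
        simp [integral_indicator_one, measurableSet_toMeasurable, G, measureReal_def]

end Integration

section Pulls

variable {K : ℕ} (I : ℕ → Fin K) (X : ℕ → ℝ) (B C : ℕ → Fin K)

lemma pulls_succ {n : ℕ} (hn : 1 ≤ n) (i : Fin K) :
    pulls I (n + 1) i = pulls I n i + if I n = i then 1 else 0 := by
  simp only [pulls, Finset.card_filter]
  exact Finset.sum_Ico_succ_top hn _

lemma pulls_mono (i : Fin K) : Monotone (pulls I · i) := fun _ _ hab =>
  Finset.card_le_card (Finset.filter_subset_filter _ (Finset.Ico_subset_Ico_right hab))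

lemma pulls_le (n : ℕ) (i : Fin K) : pulls I n i ≤ n - 1 := by
  simpa [pulls] using Finset.card_filter_le (Finset.Ico 1 n) (fun t => I t = i)

variable {I} in
lemma pulls_lt_pulls_of_arm_eq {t n : ℕ} (ht : t ∈ Finset.Ico 1 n) {i : Fin K} (hi : I t = i) :
    pulls I t i < pulls I n i := by
  obtain ⟨h1t, htn⟩ := Finset.mem_Ico.1 ht
  calc pulls I t i < pulls I (t + 1) i := by simp [pulls_succ I h1t, hi]
    _ ≤ pulls I n i := pulls_mono I i htn

lemma pulls_mul_empMean (n : ℕ) (i : Fin K) :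
    pulls I n i * empMean I X n i = ∑ t ∈ Finset.Ico 1 n with I t = i, X t := by
  refine mul_div_cancel_of_imp' fun h => ?_
  rw [Finset.card_eq_zero.1 (Nat.cast_eq_zero.1 h), Finset.sum_empty]

lemma pairCount_succ (n : ℕ) (i j : Fin K) :
    pairCount B C (n + 1) i j =
      pairCount B C n i j + if K < n ∧ B n = i ∧ C n = j then 1 else 0 :=
  card_filter_Ioo_succ _ K n

lemma pairChallengerPulls_succ (n : ℕ) (i j : Fin K) :
    pairChallengerPulls I B C (n + 1) i j =
      pairChallengerPulls I B C n i j + if K < n ∧ B n = i ∧ C n = j ∧ I n = j then 1 else 0 :=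
  card_filter_Ioo_succ _ K n

lemma pairChallengerPulls_le_pulls (n : ℕ) (i j : Fin K) :
    pairChallengerPulls I B C n i j ≤ pulls I n j := by
  refine Finset.card_le_card fun t => ?_
  simp only [Finset.mem_filter, Finset.mem_Ioo, Finset.mem_Ico]
  rintro ⟨⟨hKt, htn⟩, -, -, hj⟩
  exact ⟨⟨by omega, htn⟩, hj⟩

lemma card_le_of_pairCount_le {S : Finset ℕ} {q : ℕ} (hS : ∀ n ∈ S, K < n)
    (hq : ∀ n ∈ S, pairCount B C n (B n) (C n) ≤ q) : S.card ≤ K ^ 2 * (q + 1) := by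
  have hcard := card_le_card_mul_of_card_filter_lt_le (fun n => (B n, C n)) (S := S) (q := q)
    fun n hn => (Finset.card_le_card fun t => ?_).trans (hq n hn)
  · simpa [sq] using hcard
  · simp only [Finset.mem_filter, Finset.mem_Ioo, Prod.mk.injEq]
    exact fun ⟨htS, htn, hpair⟩ => ⟨⟨hS t htS, htn⟩, hpair⟩

end Pulls

section Tracking

variable {K : ℕ} {I : ℕ → Fin K} {X : ℕ → ℝ} {B C : ℕ → Fin K} {ε₀ β : ℝ}

lemma FollowsEBTC.one_le_pulls (h : FollowsEBTC ε₀ β I X B C) {n : ℕ} (hn : K < n)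
    (i : Fin K) : 1 ≤ pulls I n i :=
  (h.init i).symm.le.trans (pulls_mono I i hn)

lemma FollowsEBTC.tracking_bounds (h : FollowsEBTC ε₀ β I X B C) (hβ : β ∈ Set.Icc 0 1) (n : ℕ)
    (i j : Fin K) :
    (pairChallengerPulls I B C n i j : ℝ) ∈
      Set.Icc ((1 - β) * pairCount B C n i j) ((1 - β) * pairCount B C n i j + 1) := by
  obtain ⟨hβ0, hβ1⟩ := hβ
  induction n with
  | zero => simp [pairCount, pairChallengerPulls]
  | succ n ih =>
    obtain ⟨hlower, hupper⟩ := ih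
    by_cases hn : K < n ∧ B n = i ∧ C n = j
    · obtain ⟨hKn, rfl, rfl⟩ := hn
      have htrack := h.tracking n hKn
      have hcount : pairCount B C (n + 1) (B n) (C n) = pairCount B C n (B n) (C n) + 1 := by
        rw [pairCount_succ, if_pos ⟨hKn, rfl, rfl⟩]
      rw [hcount, Nat.cast_succ] at htrack ⊢
      rw [pairChallengerPulls_succ]
      split_ifs at htrack with hchallenger
      · rw [if_pos ⟨hKn, rfl, rfl, htrack⟩, Nat.cast_succ]
        constructor <;> linarith
      · rw [if_neg fun hI => h.challenger_ne n hKn (hI.2.2.2.symm.trans htrack), add_zero]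
        constructor <;> linarith
    · rw [pairCount_succ, pairChallengerPulls_succ, if_neg hn,
        if_neg fun hI => hn ⟨hI.1, hI.2.1, hI.2.2.1⟩]
      exact ⟨hlower, hupper⟩

lemma FollowsEBTC.pairCount_le_add (h : FollowsEBTC ε₀ β I X B C) (n : ℕ) (i j : Fin K) :
    pairCount B C n i j ≤ pairChallengerPulls I B C n i j + pulls I n i := by
  refine (Finset.card_le_card fun t => ?_).trans (Finset.card_union_le _ _)
  simp only [Finset.mem_filter, Finset.mem_Ioo, Finset.mem_Ico, Finset.mem_union]
  rintro ⟨⟨hKt, htn⟩, rfl, rfl⟩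
  have htrack := h.tracking t hKt
  split_ifs at htrack
  · exact Or.inl ⟨⟨hKt, htn⟩, rfl, rfl, htrack⟩
  · exact Or.inr ⟨⟨by omega, htn⟩, htrack⟩

lemma FollowsEBTC.min_mul_pairCount_le (h : FollowsEBTC ε₀ β I X B C) (hβ : β ∈ Set.Icc 0 1)
    (n : ℕ) (i j : Fin K) :
    min β (1 - β) * pairCount B C n i j ≤ (min (pulls I n i) (pulls I n j) : ℕ) + 1 := by
  obtain ⟨hlower, hupper⟩ := h.tracking_bounds hβ n i j
  have hleader : (pairCount B C n i j : ℝ) ≤ pairChallengerPulls I B C n i j + pulls I n i :=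
    mod_cast h.pairCount_le_add n i j
  have hchallenger : (pairChallengerPulls I B C n i j : ℝ) ≤ pulls I n j :=
    mod_cast pairChallengerPulls_le_pulls I B C n i j
  rw [Nat.cast_min, ← min_add_add_right, le_min_iff]
  constructor
  · calc min β (1 - β) * pairCount B C n i j ≤ β * pairCount B C n i j := by
          gcongr; exact min_le_left _ _
      _ ≤ pulls I n i + 1 := by linarith
  · calc min β (1 - β) * pairCount B C n i j ≤ (1 - β) * pairCount B C n i j := by
          gcongr; exact min_le_right _ _
      _ ≤ pulls I n j + 1 := by linarith

end Tracking

section Leader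

variable {K : ℕ} {I : ℕ → Fin K} {X : ℕ → ℝ} {B C : ℕ → Fin K} {ε₀ β : ℝ}

/-- Confidence radius, at level `D`, of the empirical mean of an arm pulled `N` times: `m / 4` if
`D ≤ N`, and `m / 4 * √(D / N)` otherwise. -/
noncomputable def radius (m : ℝ) (D N : ℕ) : ℝ := m / 4 * √((max N D : ℕ) / N)

lemma radius_nonneg {m : ℝ} (hm : 0 ≤ m) (D N : ℕ) : 0 ≤ radius m D N := by
  unfold radius
  positivity

lemma radius_of_le (m : ℝ) {D N : ℕ} (hN : 1 ≤ N) (hDN : D ≤ N) : radius m D N = m / 4 := by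
  have : (N : ℝ) ≠ 0 := by positivity
  simp [radius, max_eq_left hDN, div_self this]

lemma radius_mul_sqrt (m : ℝ) {D N : ℕ} (hN : 1 ≤ N) :
    radius m D N * √N = m / 4 * √(max N D : ℕ) := by
  have : (N : ℝ) ≠ 0 := by positivity
  rw [radius, mul_assoc, ← Real.sqrt_mul (by positivity), div_mul_cancel₀ _ this]

lemma mul_radius_sq (m : ℝ) (D : ℕ) {N : ℕ} (hN : 1 ≤ N) :
    N * radius m D N ^ 2 = m ^ 2 / 16 * (max N D : ℕ) := by
  calc N * radius m D N ^ 2 = (radius m D N * √N) ^ 2 := by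
        rw [mul_pow, Real.sq_sqrt (by positivity), mul_comm]
    _ = m ^ 2 / 16 * (max N D : ℕ) := by
        rw [radius_mul_sqrt m hN, mul_pow, Real.sq_sqrt (by positivity)]
        ring

lemma le_transportCost {n : ℕ} {i j : Fin K} {N : ℝ} (hε : 0 ≤ ε₀) (hN : 0 < N)
    (hi : N ≤ pulls I n i) (hj : N ≤ pulls I n j) (hmean : empMean I X n j ≤ empMean I X n i) :
    ε₀ * √(N / 2) ≤ transportCost ε₀ I X n i j := by
  have hpi := hN.trans_le hi
  have hpj := hN.trans_le hj
  calc ε₀ * √(N / 2) = ε₀ / √(1 / N + 1 / N) := by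
        rw [← add_div, one_add_one_eq_two, ← inv_div, Real.sqrt_inv, ← div_eq_mul_inv]
    _ ≤ transportCost ε₀ I X n i j := by
        unfold transportCost
        gcongr
        linarith

lemma transportCost_le {n : ℕ} {i j : Fin K} (hj : 1 ≤ pulls I n j)
    (hmean : 0 ≤ empMean I X n i - empMean I X n j + ε₀) :
    transportCost ε₀ I X n i j ≤ (empMean I X n i - empMean I X n j + ε₀) * √(pulls I n j) := by
  have : (0 : ℝ) < pulls I n j := mod_cast hj
  calc transportCost ε₀ I X n i j
      ≤ (empMean I X n i - empMean I X n j + ε₀) / √(1 / pulls I n j) := by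
        unfold transportCost
        gcongr
        exact le_add_of_nonneg_left (by positivity)
    _ = (empMean I X n i - empMean I X n j + ε₀) * √(pulls I n j) := by
        rw [one_div, Real.sqrt_inv, div_inv_eq_mul]

variable {μ : Fin K → ℝ} {m : ℝ} {n D : ℕ} {s : Fin K}

lemma FollowsEBTC.pulls_lt_of_suboptimal_leader (h : FollowsEBTC ε₀ β I X B C) (hm : 0 < m)
    (hn : K < n) (hE : ∀ i, |empMean I X n i - μ i| < radius m D (pulls I n i))
    (hs : m ≤ μ s - μ (B n)) (hleader : D ≤ pulls I n (B n)) : pulls I n s < D := by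
  by_contra! hbest
  have hEs := hE s
  have hEB := hE (B n)
  rw [radius_of_le m (h.one_le_pulls hn _) hbest, abs_lt] at hEs
  rw [radius_of_le m (h.one_le_pulls hn _) hleader, abs_lt] at hEB
  linarith [h.leader n hn s]

lemma FollowsEBTC.transportCost_undersampled_le (h : FollowsEBTC ε₀ β I X B C) (hm : 0 < m)
    (hmε : m ≤ ε₀) (hn : K < n)
    (hE : ∀ i, |empMean I X n i - μ i| < radius m D (pulls I n i))
    (hs : m ≤ μ s - μ (B n)) (hleader : D ≤ pulls I n (B n)) :
    transportCost ε₀ I X n (B n) s ≤ 5 / 4 * ε₀ * √D := by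
  have hsD := h.pulls_lt_of_suboptimal_leader hm hn hE hs hleader
  have hEs := abs_lt.1 (hE s)
  have hEB := hE (B n)
  rw [radius_of_le m (h.one_le_pulls hn _) hleader, abs_lt] at hEB
  have hmean := h.leader n hn s
  calc transportCost ε₀ I X n (B n) s
      ≤ (empMean I X n (B n) - empMean I X n s + ε₀) * √(pulls I n s) :=
        transportCost_le (h.one_le_pulls hn s) (by linarith)
    _ ≤ (radius m D (pulls I n s) + ε₀) * √(pulls I n s) := by
        gcongr
        linarith
    _ = m / 4 * √D + ε₀ * √(pulls I n s) := by
        rw [add_mul, radius_mul_sqrt m (h.one_le_pulls hn s), max_eq_right hsD.le]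
    _ ≤ ε₀ / 4 * √D + ε₀ * √D := by
        have : 0 ≤ ε₀ := hm.le.trans hmε
        gcongr
    _ = 5 / 4 * ε₀ * √D := by ring

lemma FollowsEBTC.min_pulls_le_of_suboptimal_leader (h : FollowsEBTC ε₀ β I X B C) (hm : 0 < m)
    (hmε : m ≤ ε₀) (hn : K < n)
    (hE : ∀ i, |empMean I X n i - μ i| < radius m D (pulls I n i))
    (hs : m ≤ μ s - μ (B n)) : min (pulls I n (B n)) (pulls I n (C n)) ≤ 4 * D := by
  by_contra! hlt
  obtain ⟨hleader, hchallenger⟩ := lt_min_iff.1 hlt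
  have hleader' : D ≤ pulls I n (B n) := by omega
  have hsD := h.pulls_lt_of_suboptimal_leader hm hn hE hs hleader'
  have hsB : s ≠ B n := by rintro rfl; omega
  have hD : (0 : ℝ) < D := mod_cast (Nat.zero_le _).trans_lt hsD
  have hε : 0 < ε₀ := hm.trans_le hmε
  have cost_le : ε₀ * √(4 * D / 2) ≤ 5 / 4 * ε₀ * √D :=
    calc ε₀ * √(4 * D / 2) ≤ transportCost ε₀ I X n (B n) (C n) :=
          le_transportCost hε.le (by positivity) (mod_cast hleader.le) (mod_cast hchallenger.le)
            (h.leader n hn _)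
      _ ≤ transportCost ε₀ I X n (B n) s := h.challenger n hn s hsB
      _ ≤ 5 / 4 * ε₀ * √D := h.transportCost_undersampled_le hm hmε hn hE hs hleader'
  have cost_lt : 5 / 4 * ε₀ * √D < ε₀ * √(4 * D / 2) :=
    calc 5 / 4 * ε₀ * √D = ε₀ * (5 / 4 * √D) := by ring
      _ < ε₀ * (√2 * √D) := by
          have : (5 / 4 : ℝ) < √2 := Real.lt_sqrt_of_sq_lt (by norm_num)
          gcongr
      _ = ε₀ * √(4 * D / 2) := by rw [← Real.sqrt_mul (by norm_num)]; ring_nf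
  exact cost_lt.not_ge cost_le

lemma FollowsEBTC.card_suboptimal_leader_le (h : FollowsEBTC ε₀ β I X B C) (hβ : β ∈ Set.Ioo 0 1)
    (hm : 0 < m) (hmε : m ≤ ε₀) {S : Finset ℕ} (hS : ∀ n ∈ S, K < n)
    (hE : ∀ n ∈ S, ∀ i, |empMean I X n i - μ i| < radius m D (pulls I n i))
    (hs : ∀ n ∈ S, m ≤ μ s - μ (B n)) :
    (S.card : ℝ) ≤ K ^ 2 / min β (1 - β) * (4 * D + 2) := by
  have hγ : 0 < min β (1 - β) := lt_min hβ.1 (sub_pos.2 hβ.2)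
  have hpair (n : ℕ) (hn : n ∈ S) :
      pairCount B C n (B n) (C n) ≤ ⌊(4 * D + 1) / min β (1 - β)⌋₊ := by
    have hmin := h.min_pulls_le_of_suboptimal_leader hm hmε (hS n hn) (hE n hn) (hs n hn)
    refine Nat.le_floor ((le_div_iff₀' hγ).2 ?_)
    calc min β (1 - β) * pairCount B C n (B n) (C n)
        ≤ (min (pulls I n (B n)) (pulls I n (C n)) : ℕ) + 1 :=
          h.min_mul_pairCount_le (Set.Ioo_subset_Icc_self hβ) n _ _
      _ ≤ 4 * D + 1 := by gcongr; exact_mod_cast hmin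
  have hcard : (S.card : ℝ) ≤ ((K ^ 2 * (⌊(4 * D + 1) / min β (1 - β)⌋₊ + 1) : ℕ) : ℝ) :=
    Nat.cast_le.2 (card_le_of_pairCount_le B C hS hpair)
  calc (S.card : ℝ) ≤ K ^ 2 * (⌊(4 * D + 1) / min β (1 - β)⌋₊ + 1) := by
        simpa only [Nat.cast_mul, Nat.cast_pow, Nat.cast_succ] using hcard
    _ ≤ K ^ 2 * ((4 * D + 1) / min β (1 - β) + 1 / min β (1 - β)) := by
        gcongr
        · exact Nat.floor_le (by positivity)
        · exact (one_le_div₀ hγ).2 ((min_le_left _ _).trans hβ.2.le)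
    _ = K ^ 2 / min β (1 - β) * (4 * D + 2) := by ring

end Leader

section ExponentialMartingale

variable {K : ℕ} (I : ℕ → Fin K) (X : ℕ → ℝ) (i : Fin K) (μ l : ℝ)

/-- Logarithm of the exponential supermartingale of parameter `l` of the rewards of arm `i` centred
at `μ`, stopped when the arm has been pulled `N` times. -/
noncomputable def chernoffExponent (N n : ℕ) : ℝ :=
  ∑ t ∈ Finset.Ico 1 n, if I t = i ∧ pulls I t i < N then l * (X t - μ) - l ^ 2 / 2 else 0

lemma chernoffExponent_succ (N : ℕ) {n : ℕ} (hn : 1 ≤ n) :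
    chernoffExponent I X i μ l N (n + 1) = chernoffExponent I X i μ l N n +
      if I n = i ∧ pulls I n i < N then l * (X n - μ) - l ^ 2 / 2 else 0 :=
  Finset.sum_Ico_succ_top hn _

lemma chernoffExponent_pulls {n T : ℕ} (hnT : n ≤ T) :
    chernoffExponent I X i μ l (pulls I n i) T =
      pulls I n i * (l * (empMean I X n i - μ) - l ^ 2 / 2) := by
  have active_iff : {t ∈ Finset.Ico 1 T | I t = i ∧ pulls I t i < pulls I n i} =
      {t ∈ Finset.Ico 1 n | I t = i} := by
    ext t
    simp only [Finset.mem_filter, Finset.mem_Ico]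
    refine ⟨fun ⟨ht, hi, hlt⟩ => ⟨⟨ht.1, (pulls_mono I i).reflect_lt hlt⟩, hi⟩,
      fun ⟨ht, hi⟩ => ⟨⟨ht.1, ht.2.trans_le hnT⟩, hi, pulls_lt_pulls_of_arm_eq ?_ hi⟩⟩
    exact Finset.mem_Ico.2 ht
  have card_eq : (Finset.card {t ∈ Finset.Ico 1 n | I t = i} : ℝ) = pulls I n i := rfl
  rw [chernoffExponent, ← Finset.sum_filter, active_iff, Finset.sum_sub_distrib, ← Finset.mul_sum,
    Finset.sum_sub_distrib, ← pulls_mul_empMean, Finset.sum_const, Finset.sum_const, nsmul_eq_mul,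
    nsmul_eq_mul, card_eq]
  ring

end ExponentialMartingale

section BanditRun

variable {K : ℕ} {Ω : Type*} {mΩ : MeasurableSpace Ω}

/-- The arms `I` and the rewards `X` come from the interaction of an arbitrary sampling rule with
the bandit instance `ν`; `ℱ n` is the information available when the reward of round `n` is drawn.
The concentration bounds hold at this generality. -/
structure IsBanditRun (ν : Fin K → Measure ℝ) (P : Measure Ω) (ℱ : Filtration ℕ mΩ)
    (I : ℕ → Ω → Fin K) (X : ℕ → Ω → ℝ) : Prop where
  measurable_arm : ∀ n, 1 ≤ n → Measurable[ℱ n] (I n)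
  measurable_reward : ∀ n, 1 ≤ n → Measurable[ℱ (n + 1)] (X n)
  reward_law : ∀ n, 1 ≤ n → ∀ A : Set Ω, MeasurableSet[ℱ n] A → ∀ (i : Fin K) (s : Set ℝ),
    MeasurableSet s →
      P (A ∩ {ω | I n ω = i} ∩ {ω | X n ω ∈ s}) = P (A ∩ {ω | I n ω = i}) * ν i s

variable {ν : Fin K → Measure ℝ} {P : Measure Ω} {ℱ : Filtration ℕ mΩ} {I : ℕ → Ω → Fin K}
  {X : ℕ → Ω → ℝ}

lemma IsEBTCRun.isBanditRun {ε₀ β : ℝ} {B C : ℕ → Ω → Fin K}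
    (h : IsEBTCRun ε₀ β ν P ℱ I X B C) : IsBanditRun ν P ℱ I X :=
  ⟨h.measurable_arm, h.measurable_reward, h.reward_law⟩

lemma IsBanditRun.measurableSet_arm_eq (h : IsBanditRun ν P ℱ I X) {t n : ℕ} (ht : 1 ≤ t)
    (htn : t ≤ n) (i : Fin K) : MeasurableSet[ℱ n] {ω | I t ω = i} :=
  ℱ.mono htn _ (h.measurable_arm t ht (measurableSet_singleton i))

lemma IsBanditRun.measurableSet_active (h : IsBanditRun ν P ℱ I X) {n : ℕ} (hn : 1 ≤ n)
    (i : Fin K) (N : ℕ) :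
    MeasurableSet[ℱ n] {ω | I n ω = i ∧ pulls (I · ω) n i < N} := by
  have measurable_pulls : Measurable[ℱ n] fun ω => pulls (I · ω) n i := by
    simp only [pulls, Finset.card_filter]
    refine Finset.measurable_sum _ fun t ht => ?_
    obtain ⟨h1t, htn⟩ := Finset.mem_Ico.1 ht
    exact Measurable.ite (h.measurableSet_arm_eq h1t htn.le i) measurable_const measurable_const
  exact (h.measurableSet_arm_eq hn le_rfl i).inter (measurable_pulls measurableSet_Iio)

lemma IsBanditRun.measurable_chernoffExponent (h : IsBanditRun ν P ℱ I X) (i : Fin K) (μ l : ℝ)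
    (N n : ℕ) : Measurable[ℱ n] fun ω => chernoffExponent (I · ω) (X · ω) i μ l N n := by
  refine Finset.measurable_sum _ fun t ht => ?_
  obtain ⟨h1t, htn⟩ := Finset.mem_Ico.1 ht
  have hX : Measurable[ℱ n] (X t) := (h.measurable_reward t h1t).mono (ℱ.mono htn) le_rfl
  exact Measurable.ite (ℱ.mono htn.le _ (h.measurableSet_active h1t i N))
    (((hX.sub_const μ).const_mul l).sub_const _) measurable_const

lemma IsBanditRun.setLIntegral_inter_reward (h : IsBanditRun ν P ℱ I X) {n : ℕ} (hn : 1 ≤ n)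
    {i : Fin K} {s : Set Ω} (hs : MeasurableSet[ℱ n] s) (hsi : s ⊆ {ω | I n ω = i})
    {f : Ω → ENNReal} (hf : Measurable[ℱ n] f) {u : Set ℝ} (hu : MeasurableSet u) :
    ∫⁻ ω in X n ⁻¹' u ∩ s, f ω ∂P = (∫⁻ ω in s, f ω ∂P) * ν i u := by
  have htrim : (P.restrict (X n ⁻¹' u ∩ s)).trim (ℱ.le n) =
      ν i u • (P.restrict s).trim (ℱ.le n) := by
    refine @Measure.ext _ (ℱ n) _ _ fun t ht => ?_
    have hts : t ∩ s ∩ {ω | I n ω = i} = t ∩ s :=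
      Set.inter_eq_left.2 (Set.inter_subset_right.trans hsi)
    have hlaw := h.reward_law n hn (t ∩ s) (ht.inter hs) i u hu
    rw [hts] at hlaw
    rw [Measure.smul_apply, trim_measurableSet_eq _ ht, trim_measurableSet_eq _ ht,
      Measure.restrict_apply (ℱ.le n _ ht), Measure.restrict_apply (ℱ.le n _ ht), smul_eq_mul,
      mul_comm, ← hlaw, Set.inter_comm (X n ⁻¹' u), ← Set.inter_assoc]
    rfl
  rw [← lintegral_trim (ℱ.le n) hf, htrim, lintegral_smul_measure, lintegral_trim (ℱ.le n) hf,
    smul_eq_mul, mul_comm]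

lemma IsBanditRun.setLIntegral_mul_reward (h : IsBanditRun ν P ℱ I X) {n : ℕ} (hn : 1 ≤ n)
    {i : Fin K} {s : Set Ω} (hs : MeasurableSet[ℱ n] s) (hsi : s ⊆ {ω | I n ω = i})
    {f : Ω → ENNReal} (hf : Measurable[ℱ n] f) {g : ℝ → ENNReal} (hg : Measurable g) :
    ∫⁻ ω in s, f ω * g (X n ω) ∂P = (∫⁻ ω in s, f ω ∂P) * ∫⁻ x, g x ∂(ν i) := by
  have hX : Measurable (X n) := (h.measurable_reward n hn).mono (ℱ.le _) le_rfl
  have hf' : Measurable f := hf.mono (ℱ.le n) le_rfl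
  have hmap : ((P.restrict s).withDensity f).map (X n) = (∫⁻ ω in s, f ω ∂P) • ν i := by
    ext u hu
    rw [Measure.map_apply hX hu, withDensity_apply _ (hX hu), Measure.restrict_restrict (hX hu),
      h.setLIntegral_inter_reward hn hs hsi hf hu, Measure.smul_apply, smul_eq_mul]
  calc ∫⁻ ω in s, f ω * g (X n ω) ∂P
      = ∫⁻ ω, g (X n ω) ∂(P.restrict s).withDensity f :=
        (lintegral_withDensity_eq_lintegral_mul _ hf' (hg.comp hX)).symm
    _ = ∫⁻ x, g x ∂((P.restrict s).withDensity f).map (X n) := (lintegral_map hg hX).symm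
    _ = (∫⁻ ω in s, f ω ∂P) * ∫⁻ x, g x ∂(ν i) := by
        rw [hmap, lintegral_smul_measure, smul_eq_mul]

lemma IsBanditRun.lintegral_exp_chernoffExponent_succ_le (h : IsBanditRun ν P ℱ I X) {i : Fin K}
    (hν : IsOneSubGaussian (ν i)) (l : ℝ) (N : ℕ) {n : ℕ} (hn : 1 ≤ n) :
    ∫⁻ ω, ENNReal.ofReal (Real.exp
        (chernoffExponent (I · ω) (X · ω) i (armMean ν i) l N (n + 1))) ∂P ≤
      ∫⁻ ω, ENNReal.ofReal (Real.exp
        (chernoffExponent (I · ω) (X · ω) i (armMean ν i) l N n)) ∂P := by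
  let Z (k : ℕ) (ω : Ω) : ENNReal :=
    ENNReal.ofReal (Real.exp (chernoffExponent (I · ω) (X · ω) i (armMean ν i) l N k))
  let step (x : ℝ) : ENNReal := ENNReal.ofReal (Real.exp (l * (x - armMean ν i) - l ^ 2 / 2))
  change ∫⁻ ω, Z (n + 1) ω ∂P ≤ ∫⁻ ω, Z n ω ∂P
  let active : Set Ω := {ω | I n ω = i ∧ pulls (I · ω) n i < N}
  have hactive : MeasurableSet[ℱ n] active := h.measurableSet_active hn i N
  have Z_succ_active : ∀ ω ∈ active, Z (n + 1) ω = Z n ω * step (X n ω) := fun ω ⟨hi, hlt⟩ => by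
    simp only [Z, step]
    rw [chernoffExponent_succ _ _ _ _ _ _ hn, if_pos ⟨hi, hlt⟩, Real.exp_add,
      ENNReal.ofReal_mul (Real.exp_nonneg _)]
  have Z_succ_stopped : ∀ ω ∈ activeᶜ, Z (n + 1) ω = Z n ω :=
      fun ω (hω : ¬ (I n ω = i ∧ pulls (I · ω) n i < N)) => by
    simp only [Z]
    rw [chernoffExponent_succ _ _ _ _ _ _ hn, if_neg hω, add_zero]
  have hZ : Measurable[ℱ n] (Z n) :=
    (h.measurable_chernoffExponent i (armMean ν i) l N n).exp.ennreal_ofReal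
  have integral_active_le : ∫⁻ ω in active, Z (n + 1) ω ∂P ≤ ∫⁻ ω in active, Z n ω ∂P := by
    rw [setLIntegral_congr_fun (ℱ.le n _ hactive) Z_succ_active,
      h.setLIntegral_mul_reward hn hactive (fun _ hω => hω.1) hZ (by fun_prop)]
    exact mul_le_of_le_one_right' (hν.lintegral_exp_le_one l)
  rw [← lintegral_add_compl (Z (n + 1)) (ℱ.le n _ hactive),
    ← lintegral_add_compl (Z n) (ℱ.le n _ hactive),
    setLIntegral_congr_fun (ℱ.le n _ hactive).compl Z_succ_stopped]
  gcongr

lemma IsBanditRun.lintegral_exp_chernoffExponent_le_one [IsProbabilityMeasure P]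
    (h : IsBanditRun ν P ℱ I X) {i : Fin K} (hν : IsOneSubGaussian (ν i)) (l : ℝ) (N : ℕ) {n : ℕ}
    (hn : 1 ≤ n) :
    ∫⁻ ω, ENNReal.ofReal (Real.exp
      (chernoffExponent (I · ω) (X · ω) i (armMean ν i) l N n)) ∂P ≤ 1 := by
  induction n, hn using Nat.le_induction with
  | base => simp [chernoffExponent]
  | succ n hn ih => exact (h.lintegral_exp_chernoffExponent_succ_le hν l N hn).trans ih

lemma IsBanditRun.measureReal_exists_deviation_le [IsProbabilityMeasure P]
    (h : IsBanditRun ν P ℱ I X) {i : Fin K} (hν : IsOneSubGaussian (ν i)) {x : ℝ} (hx : 0 ≤ x)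
    (N T : ℕ) :
    P.real {ω | ∃ n ≤ T, pulls (I · ω) n i = N ∧
      x ≤ |empMean (I · ω) (X · ω) n i - armMean ν i|} ≤ 2 * Real.exp (-(N * x ^ 2 / 2)) := by
  let crossing (l : ℝ) : Set Ω :=
    {ω | N * x ^ 2 / 2 ≤ chernoffExponent (I · ω) (X · ω) i (armMean ν i) l N (T + 1)}
  have crossing_le (l : ℝ) : P.real (crossing l) ≤ Real.exp (-(N * x ^ 2 / 2)) :=
    measureReal_le_exp_neg_of_lintegral_exp_le_one
      ((h.measurable_chernoffExponent i _ l N _).mono (ℱ.le _) le_rfl)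
      (h.lintegral_exp_chernoffExponent_le_one hν l N (Nat.le_add_left 1 T)) _
  calc _ ≤ P.real (crossing x ∪ crossing (-x)) := by
        refine measureReal_mono fun ω ⟨n, hnT, hN, hdev⟩ => ?_
        have exponent_eq (l : ℝ) := chernoffExponent_pulls (I · ω) (X · ω) i (armMean ν i) l
          (hnT.trans (Nat.le_succ T))
        simp only [hN] at exponent_eq
        refine (le_abs.1 hdev).imp (fun hle => ?_) (fun hle => ?_) <;>
        · simp only [crossing, Set.mem_ofPred_eq, exponent_eq, mul_div_assoc]
          gcongr
          nlinarith
    _ ≤ P.real (crossing x) + P.real (crossing (-x)) := measureReal_union_le _ _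
    _ ≤ 2 * Real.exp (-(N * x ^ 2 / 2)) := by linarith [crossing_le x, crossing_le (-x)]

/-- Trajectories along which, before round `T` at the latest, the empirical mean of some arm leaves
its confidence interval of level `D`. -/
def confidenceFailure (I : ℕ → Ω → Fin K) (X : ℕ → Ω → ℝ) (μ : Fin K → ℝ) (m : ℝ) (T D : ℕ) :
    Set Ω :=
  {ω | ∃ n ≤ T, ∃ i, 1 ≤ pulls (I · ω) n i ∧
    radius m D (pulls (I · ω) n i) ≤ |empMean (I · ω) (X · ω) n i - μ i|}

lemma IsBanditRun.measureReal_confidenceFailure_le [IsProbabilityMeasure P]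
    (h : IsBanditRun ν P ℱ I X) (hν : ∀ i, IsOneSubGaussian (ν i)) {m : ℝ} (hm : 0 < m)
    (T D : ℕ) :
    P.real (confidenceFailure I X (armMean ν) m T D) ≤
      2 * K * (1 + 64 / m ^ 2) * Real.exp (-(m ^ 2 / 64 * D)) := by
  let deviation (i : Fin K) (N : ℕ) : Set Ω := {ω | ∃ n ≤ T, pulls (I · ω) n i = N ∧
    radius m D N ≤ |empMean (I · ω) (X · ω) n i - armMean ν i|}
  have deviation_le (i : Fin K) {N : ℕ} (hN : 1 ≤ N) : P.real (deviation i N) ≤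
      2 * Real.exp (-(m ^ 2 / 64 * D)) * Real.exp (-(m ^ 2 / 64 * N)) := by
    have add_le_max : (D + N : ℝ) ≤ 2 * (max N D : ℕ) := by norm_cast; omega
    calc P.real (deviation i N) ≤ 2 * Real.exp (-(N * radius m D N ^ 2 / 2)) :=
          h.measureReal_exists_deviation_le (hν i) (radius_nonneg hm.le D N) N T
      _ = 2 * Real.exp (-(m ^ 2 / 64 * (2 * (max N D : ℕ)))) := by
          rw [mul_radius_sq m D hN]; ring_nf
      _ ≤ 2 * Real.exp (-(m ^ 2 / 64 * (D + N))) := by gcongr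
      _ = 2 * Real.exp (-(m ^ 2 / 64 * D)) * Real.exp (-(m ^ 2 / 64 * N)) := by
          rw [mul_assoc, ← Real.exp_add]; ring_nf
  calc P.real (confidenceFailure I X (armMean ν) m T D)
      ≤ P.real (⋃ i, ⋃ N ∈ Finset.Icc 1 T, deviation i N) := by
        refine measureReal_mono fun ω ⟨n, hnT, i, hpos, hdev⟩ => Set.mem_iUnion.2 ⟨i, ?_⟩
        have hle : pulls (I · ω) n i ≤ T := (pulls_le _ n i).trans (by omega)
        exact Set.mem_biUnion (Finset.mem_Icc.2 ⟨hpos, hle⟩) ⟨n, hnT, rfl, hdev⟩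
    _ ≤ ∑ i, ∑ N ∈ Finset.Icc 1 T, P.real (deviation i N) :=
        (measureReal_iUnion_fintype_le _).trans
          (Finset.sum_le_sum fun i _ => measureReal_biUnion_finset_le _ _)
    _ ≤ ∑ _i : Fin K, 2 * Real.exp (-(m ^ 2 / 64 * D)) * (1 + (m ^ 2 / 64)⁻¹) := by
        refine Finset.sum_le_sum fun i _ => (Finset.sum_le_sum fun N hN =>
          deviation_le i (Finset.mem_Icc.1 hN).1).trans ?_
        rw [← Finset.mul_sum]
        gcongr
        exact sum_exp_neg_mul_le (by positivity) _
    _ = 2 * K * (1 + 64 / m ^ 2) * Real.exp (-(m ^ 2 / 64 * D)) := by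
        rw [Finset.sum_const, Finset.card_univ, Fintype.card_fin, nsmul_eq_mul, inv_div]
        ring

lemma IsBanditRun.sum_measureReal_confidenceFailure_le [IsProbabilityMeasure P]
    (h : IsBanditRun ν P ℱ I X) (hν : ∀ i, IsOneSubGaussian (ν i)) {m : ℝ} (hm : 0 < m)
    (T D₀ : ℕ) :
    ∑ D ∈ Finset.Ico D₀ (D₀ + T), P.real (confidenceFailure I X (armMean ν) m T D) ≤
      2 * K * (1 + 64 / m ^ 2) ^ 2 * Real.exp (-(m ^ 2 / 64 * D₀)) := by
  calc ∑ D ∈ Finset.Ico D₀ (D₀ + T), P.real (confidenceFailure I X (armMean ν) m T D)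
      ≤ ∑ D ∈ Finset.Ico D₀ (D₀ + T),
          2 * K * (1 + 64 / m ^ 2) * Real.exp (-(m ^ 2 / 64 * D)) :=
        Finset.sum_le_sum fun D _ => h.measureReal_confidenceFailure_le hν hm T D
    _ ≤ 2 * K * (1 + 64 / m ^ 2) *
          (Real.exp (-(m ^ 2 / 64 * D₀)) * (1 + (m ^ 2 / 64)⁻¹)) := by
        rw [← Finset.mul_sum]
        gcongr
        exact sum_Ico_exp_neg_mul_le (by positivity) D₀ T
    _ = 2 * K * (1 + 64 / m ^ 2) ^ 2 * Real.exp (-(m ^ 2 / 64 * D₀)) := by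
        rw [inv_div]
        ring

end BanditRun

section Gaps

variable {K : ℕ} (ν : Fin K → Measure ℝ)

lemma gap_nonneg (i : Fin K) : 0 ≤ gap ν i :=
  sub_nonneg.2 (le_ciSup (Set.finite_range (armMean ν)).bddAbove i)

lemma gap_le_maxGap (i : Fin K) : gap ν i ≤ maxGap ν := le_ciSup (Set.finite_range _).bddAbove i

lemma maxGap_nonneg : 0 ≤ maxGap ν := Real.iSup_nonneg (gap_nonneg ν)

lemma exists_armMean_eq_bestMean [Nonempty (Fin K)] : ∃ s, armMean ν s = bestMean ν :=
  exists_eq_ciSup_of_finite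

variable {ν}

lemma minGap_le {i : Fin K} (hi : 0 < gap ν i) : minGap ν ≤ gap ν i :=
  csInf_le ⟨0, by rintro x ⟨j, hj, rfl⟩; exact hj.le⟩ ⟨i, hi, rfl⟩

lemma minGap_pos (h : ∃ i, 0 < gap ν i) : 0 < minGap ν := by
  obtain ⟨i, hi⟩ := h
  have hfinite : {x : ℝ | ∃ i, 0 < gap ν i ∧ x = gap ν i}.Finite :=
    (Set.finite_range (gap ν)).subset (by rintro x ⟨j, -, rfl⟩; exact ⟨j, rfl⟩)
  have hnonempty : {x : ℝ | ∃ i, 0 < gap ν i ∧ x = gap ν i}.Nonempty := ⟨gap ν i, i, hi, rfl⟩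
  obtain ⟨j, hj, hmin⟩ := hnonempty.csInf_mem hfinite
  exact hj.trans_eq hmin.symm

variable (ν) in
lemma exists_pos_le_gap {ε₀ : ℝ} (hε : 0 < ε₀) :
    ∃ m, 0 < m ∧ m ≤ ε₀ ∧ ∀ i, 0 < gap ν i → m ≤ gap ν i := by
  by_cases hgap : ∃ i, 0 < gap ν i
  · exact ⟨min (minGap ν) ε₀, lt_min (minGap_pos hgap) hε, min_le_right _ _,
      fun i hi => (min_le_left _ _).trans (minGap_le hi)⟩
  · exact ⟨ε₀, hε, le_rfl, fun i hi => (hgap ⟨i, hi⟩).elim⟩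

end Gaps

section Constants

lemma add_mul_le_mul_sq {a b l L : ℝ} (ha : 0 ≤ a) (hb : 0 ≤ b) (hl : 0 < l) (hL : l ≤ L) :
    a + b * L ≤ (a / l ^ 2 + b / l) * L ^ 2 := by
  have one_le : 1 ≤ L / l := (one_le_div₀ hl).2 hL
  calc a + b * L = a * 1 + b * L * 1 := by ring
    _ ≤ a * (L / l) ^ 2 + b * L * (L / l) := by
        have : 0 < L := hl.trans_le hL
        gcongr
        exact one_le_pow₀ one_le
    _ = (a / l ^ 2 + b / l) * L ^ 2 := by ring

lemma log_mul_one_add_le {K ρ : ℝ} (hK : 1 ≤ K) (hρ : 1 ≤ ρ) :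
    Real.log (K * (1 + 64 * ρ / K)) ≤ K * (64 + Real.log ρ) := by
  have hlog : 0 ≤ Real.log ρ := Real.log_nonneg hρ
  calc Real.log (K * (1 + 64 * ρ / K)) ≤ Real.log (K * 65 * ρ) := by
        refine Real.log_le_log (by positivity) ?_
        rw [mul_add, mul_one, mul_div_cancel₀ _ (by positivity)]
        nlinarith
    _ = Real.log K + Real.log 65 + Real.log ρ := by
        rw [Real.log_mul (by positivity) (by positivity),
          Real.log_mul (by positivity) (by positivity)]
    _ ≤ (K - 1) + (65 - 1) + Real.log ρ := by
        gcongr <;> exact Real.log_le_sub_one_of_pos (by positivity)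
    _ ≤ K * (64 + Real.log ρ) := by nlinarith

lemma log_term_le {K ρ l : ℝ} (hK : 1 ≤ K) (hρ : 1 ≤ ρ) (hl : 0 < l) (hlρ : l ≤ Real.log ρ) :
    4 * (64 * ρ / K) * Real.log (K * (1 + 64 * ρ / K)) + 8 * (64 * ρ / K) + 14 ≤
      (16910 / l ^ 2 + 256 / l) * (ρ * Real.log ρ ^ 2) := by
  calc 4 * (64 * ρ / K) * Real.log (K * (1 + 64 * ρ / K)) + 8 * (64 * ρ / K) + 14
      ≤ 4 * (64 * ρ / K) * (K * (64 + Real.log ρ)) + 8 * (64 * ρ) + 14 * ρ := by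
        gcongr
        · exact log_mul_one_add_le hK hρ
        · exact div_le_self (by positivity) hK
        · linarith
    _ = ρ * (16910 + 256 * Real.log ρ) := by field_simp; ring
    _ ≤ ρ * ((16910 / l ^ 2 + 256 / l) * Real.log ρ ^ 2) := by
        gcongr
        exact add_mul_le_mul_sq (by norm_num) (by norm_num) hl hlρ
    _ = (16910 / l ^ 2 + 256 / l) * (ρ * Real.log ρ ^ 2) := by ring

end Constants

section Regret

variable {K : ℕ} {ε₀ β m : ℝ} {ν : Fin K → Measure ℝ}

lemma FollowsEBTC.sum_gap_leader_le {I : ℕ → Fin K} {X : ℕ → ℝ} {B C : ℕ → Fin K}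
    (h : FollowsEBTC ε₀ β I X B C) (hβ : β ∈ Set.Ioo 0 1) (hm : 0 < m) (hmε : m ≤ ε₀)
    (hgap : ∀ i, 0 < gap ν i → m ≤ gap ν i) {D T : ℕ}
    (hE : ∀ n ∈ Finset.Icc (K + 1) T, ∀ i,
      |empMean I X n i - armMean ν i| < radius m D (pulls I n i)) :
    ∑ n ∈ Finset.Icc (K + 1) T, gap ν (B n) ≤
      maxGap ν * (K ^ 2 / min β (1 - β) * (4 * D + 2)) := by
  have : Nonempty (Fin K) := ⟨B 0⟩
  obtain ⟨s, hs⟩ := exists_armMean_eq_bestMean ν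
  let suboptimal : Finset ℕ := {n ∈ Finset.Icc (K + 1) T | 0 < gap ν (B n)}
  have card_le : (suboptimal.card : ℝ) ≤ K ^ 2 / min β (1 - β) * (4 * D + 2) := by
    refine h.card_suboptimal_leader_le hβ hm hmε (μ := armMean ν) (s := s)
      (fun n hn => ?_) (fun n hn => hE n (Finset.mem_filter.1 hn).1) (fun n hn => ?_)
    · exact (Finset.mem_Icc.1 (Finset.mem_filter.1 hn).1).1
    · rw [hs]
      exact hgap _ (Finset.mem_filter.1 hn).2
  calc ∑ n ∈ Finset.Icc (K + 1) T, gap ν (B n) = ∑ n ∈ suboptimal, gap ν (B n) :=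
        (Finset.sum_filter_of_ne fun n _ hne => (gap_nonneg ν _).lt_of_ne' hne).symm
    _ ≤ suboptimal.card • maxGap ν := Finset.sum_le_card_nsmul _ _ _ fun n _ => gap_le_maxGap ν _
    _ = maxGap ν * suboptimal.card := by rw [nsmul_eq_mul, mul_comm]
    _ ≤ maxGap ν * (K ^ 2 / min β (1 - β) * (4 * D + 2)) :=
        mul_le_mul_of_nonneg_left card_le (maxGap_nonneg ν)

variable {Ω : Type*} {mΩ : MeasurableSpace Ω} {P : Measure Ω} {ℱ : Filtration ℕ mΩ}
  {I : ℕ → Ω → Fin K} {X : ℕ → Ω → ℝ} {B C : ℕ → Ω → Fin K}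

lemma IsEBTCRun.sum_gap_leader_le_of_notMem_confidenceFailure
    (h : IsEBTCRun ε₀ β ν P ℱ I X B C) (hβ : β ∈ Set.Ioo 0 1) (hm : 0 < m) (hmε : m ≤ ε₀)
    (hgap : ∀ i, 0 < gap ν i → m ≤ gap ν i) {T D : ℕ} {ω : Ω}
    (hω : ω ∉ confidenceFailure I X (armMean ν) m T D) :
    ∑ n ∈ Finset.Icc (K + 1) T, gap ν (B n ω) ≤
      maxGap ν * (K ^ 2 / min β (1 - β) * (4 * D + 2)) := by
  refine (h.follows ω).sum_gap_leader_le hβ hm hmε hgap fun n hn i => ?_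
  obtain ⟨hKn, hnT⟩ := Finset.mem_Icc.1 hn
  by_contra! hdev
  exact hω ⟨n, hnT, i, (h.follows ω).one_le_pulls hKn i, hdev⟩

lemma IsEBTCRun.inducedRegret_eq_integral_sum [IsFiniteMeasure P]
    (h : IsEBTCRun ε₀ β ν P ℱ I X B C) (T : ℕ) :
    inducedRegret ν P B T = ∫ ω, ∑ n ∈ Finset.Icc (K + 1) T, gap ν (B n ω) ∂P := by
  refine (integral_finsetSum _ fun n hn => ?_).symm
  have hB : Measurable (B n) :=
    (h.measurable_leader n (Finset.mem_Icc.1 hn).1).mono (ℱ.le n) le_rfl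
  refine .of_bound ((measurable_of_finite (gap ν)).comp hB).aestronglyMeasurable (maxGap ν)
    (ae_of_all _ fun ω => ?_)
  exact (Real.norm_of_nonneg (gap_nonneg ν _)).trans_le (gap_le_maxGap ν _)

lemma IsEBTCRun.inducedRegret_le_sum_confidenceFailure [IsProbabilityMeasure P]
    (h : IsEBTCRun ε₀ β ν P ℱ I X B C) (hβ : β ∈ Set.Ioo 0 1) (hm : 0 < m) (hmε : m ≤ ε₀)
    (hgap : ∀ i, 0 < gap ν i → m ≤ gap ν i) (T D₀ : ℕ) :
    inducedRegret ν P B T ≤ maxGap ν * (K ^ 2 / min β (1 - β)) * (4 * (D₀ +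
      ∑ D ∈ Finset.Ico D₀ (D₀ + T), P.real (confidenceFailure I X (armMean ν) m T D)) + 2) := by
  have hγ : 0 < min β (1 - β) := lt_min hβ.1 (sub_pos.2 hβ.2)
  have hmax := maxGap_nonneg ν
  have hK : (1 : ℝ) ≤ K := mod_cast (B 0 P.nonempty_of_neZero.some).pos
  have sum_gap_le (ω : Ω) : ∑ n ∈ Finset.Icc (K + 1) T, gap ν (B n ω) ≤
      4 * (maxGap ν * (K ^ 2 / min β (1 - β))) * T := by
    have one_le : 1 ≤ (K : ℝ) ^ 2 / min β (1 - β) := by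
      rw [one_le_div₀ hγ]
      exact ((min_le_left _ _).trans hβ.2.le).trans (one_le_pow₀ hK)
    calc ∑ n ∈ Finset.Icc (K + 1) T, gap ν (B n ω)
        ≤ (Finset.Icc (K + 1) T).card • maxGap ν :=
          Finset.sum_le_card_nsmul _ _ _ fun n _ => gap_le_maxGap ν _
      _ ≤ maxGap ν * T := by
          rw [nsmul_eq_mul, mul_comm, Nat.card_Icc]
          gcongr
          omega
      _ ≤ maxGap ν * (4 * (K ^ 2 / min β (1 - β))) * T := by
          gcongr
          exact le_mul_of_one_le_right hmax (by linarith)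
      _ = 4 * (maxGap ν * (K ^ 2 / min β (1 - β))) * T := by ring
  rw [h.inducedRegret_eq_integral_sum]
  refine (integral_le_of_le_off_levels (b := 2 * (maxGap ν * (K ^ 2 / min β (1 - β))))
    (by positivity) (by positivity) T D₀ (fun ω => Finset.sum_nonneg fun n _ => gap_nonneg ν _)
    sum_gap_le fun D ω hω => ?_).trans_eq (by ring)
  exact (h.sum_gap_leader_le_of_notMem_confidenceFailure hβ hm hmε hgap hω).trans_eq (by ring)

/- The level from which the failure probabilities are summed is the one at which the union bound
`2 K (1 + u) exp (-D / u)`, with `u = 64 / m²`, becomes `O(1)`. -/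
lemma IsEBTCRun.inducedRegret_le [IsProbabilityMeasure P] (h : IsEBTCRun ε₀ β ν P ℱ I X B C)
    (hβ : β ∈ Set.Ioo 0 1) (hν : ∀ i, IsOneSubGaussian (ν i)) (hm : 0 < m)
    (hmε : m ≤ ε₀) (hgap : ∀ i, 0 < gap ν i → m ≤ gap ν i) (T : ℕ) :
    inducedRegret ν P B T ≤ maxGap ν * (K ^ 2 / min β (1 - β)) *
      (4 * (64 / m ^ 2) * Real.log (K * (1 + 64 / m ^ 2)) + 8 * (64 / m ^ 2) + 14) := by
  have hγ : 0 < min β (1 - β) := lt_min hβ.1 (sub_pos.2 hβ.2)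
  have hmax := maxGap_nonneg ν
  have hK : (1 : ℝ) ≤ K := mod_cast (B 0 P.nonempty_of_neZero.some).pos
  set u := 64 / m ^ 2
  have hu : 0 < u := by positivity
  have log_nonneg : 0 ≤ Real.log (K * (1 + u)) := Real.log_nonneg (by nlinarith)
  set D₀ := ⌈u * Real.log (K * (1 + u))⌉₊
  have level_le : (D₀ : ℝ) ≤ u * Real.log (K * (1 + u)) + 1 :=
    (Nat.ceil_lt_add_one (by positivity)).le
  have exp_level_le : Real.exp (-(m ^ 2 / 64 * D₀)) ≤ (K * (1 + u))⁻¹ := by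
    have le_level : Real.log (K * (1 + u)) ≤ m ^ 2 / 64 * D₀ := by
      calc Real.log (K * (1 + u)) = m ^ 2 / 64 * (u * Real.log (K * (1 + u))) := by
            rw [← mul_assoc, div_mul_div_cancel₀ (by positivity), div_self (by positivity), one_mul]
        _ ≤ m ^ 2 / 64 * D₀ := by
            gcongr
            exact Nat.le_ceil _
    calc Real.exp (-(m ^ 2 / 64 * D₀)) ≤ Real.exp (-Real.log (K * (1 + u))) := by gcongr
      _ = (K * (1 + u))⁻¹ := by rw [Real.exp_neg, Real.exp_log (by positivity)]
  have sum_failure_le := calc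
    ∑ D ∈ Finset.Ico D₀ (D₀ + T), P.real (confidenceFailure I X (armMean ν) m T D)
      ≤ 2 * K * (1 + u) ^ 2 * Real.exp (-(m ^ 2 / 64 * D₀)) :=
        h.isBanditRun.sum_measureReal_confidenceFailure_le hν hm T D₀
    _ ≤ 2 * K * (1 + u) ^ 2 * (K * (1 + u))⁻¹ := by gcongr
    _ = 2 * (1 + u) := by field_simp
  refine (h.inducedRegret_le_sum_confidenceFailure hβ hm hmε hgap T D₀).trans ?_
  refine mul_le_mul_of_nonneg_left ?_ (by positivity)
  linarith

lemma IsEBTCRun.inducedRegret_le_log_sq [IsProbabilityMeasure P]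
    (h : IsEBTCRun ε₀ β ν P ℱ I X B C) (hβ : β ∈ Set.Ioo 0 1) (hν : ∀ i, IsOneSubGaussian (ν i))
    (hm : 0 < m) (hmε : m ≤ ε₀) (hgap : ∀ i, 0 < gap ν i → m ≤ gap ν i) {κ : ℝ} (hκ : 1 < κ)
    (hκm : κ ≤ K / m ^ 2) (T : ℕ) :
    inducedRegret ν P B T ≤ (16910 / Real.log κ ^ 2 + 256 / Real.log κ) / min β (1 - β) *
      (K ^ 3 * maxGap ν / m ^ 2 * Real.log (K / m ^ 2) ^ 2) := by
  have hγ : 0 < min β (1 - β) := lt_min hβ.1 (sub_pos.2 hβ.2)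
  have hmax := maxGap_nonneg ν
  have hK : (1 : ℝ) ≤ K := mod_cast (B 0 P.nonempty_of_neZero.some).pos
  have level_eq : 64 / m ^ 2 = 64 * (K / m ^ 2) / K := by field_simp
  calc inducedRegret ν P B T ≤ maxGap ν * (K ^ 2 / min β (1 - β)) *
        (4 * (64 * (K / m ^ 2) / K) * Real.log (K * (1 + 64 * (K / m ^ 2) / K)) +
          8 * (64 * (K / m ^ 2) / K) + 14) := by
        rw [← level_eq]
        exact h.inducedRegret_le hβ hν hm hmε hgap T
    _ ≤ maxGap ν * (K ^ 2 / min β (1 - β)) * ((16910 / Real.log κ ^ 2 + 256 / Real.log κ) *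
          (K / m ^ 2 * Real.log (K / m ^ 2) ^ 2)) := by
        gcongr
        exact log_term_le hK (hκ.le.trans hκm) (Real.log_pos hκ)
          (Real.log_le_log (by positivity) hκm)
    _ = _ := by ring

end Regret

end EBTC

theorem mainTheorem6_general {β : ℝ} (hβ : β ∈ Set.Ioo 0 1) :
    (∀ (K : ℕ) (ε₀ : ℝ), 0 < ε₀ → ∀ ν : Fin K → Measure ℝ, (∀ i, EBTC.IsOneSubGaussian (ν i)) →
      ∃ R : ℝ, ∀ {Ω : Type*} {mΩ : MeasurableSpace Ω} (P : Measure Ω) [IsProbabilityMeasure P]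
        (ℱ : Filtration ℕ mΩ) (I : ℕ → Ω → Fin K) (X : ℕ → Ω → ℝ) (B C : ℕ → Ω → Fin K),
        EBTC.IsEBTCRun ε₀ β ν P ℱ I X B C → ∀ T : ℕ, EBTC.inducedRegret ν P B T ≤ R) ∧
    (∀ κ : ℝ, 1 < κ → ∃ c : ℝ, 0 < c ∧
      ∀ (K : ℕ) (ε₀ : ℝ), 0 < ε₀ → ∀ ν : Fin K → Measure ℝ, (∀ i, EBTC.IsOneSubGaussian (ν i)) →
        (∃ i, 0 < EBTC.gap ν i) → κ ≤ K / min (EBTC.minGap ν) ε₀ ^ 2 →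
        ∀ {Ω : Type*} {mΩ : MeasurableSpace Ω} (P : Measure Ω) [IsProbabilityMeasure P]
          (ℱ : Filtration ℕ mΩ) (I : ℕ → Ω → Fin K) (X : ℕ → Ω → ℝ) (B C : ℕ → Ω → Fin K),
          EBTC.IsEBTCRun ε₀ β ν P ℱ I X B C → ∀ T : ℕ,
            EBTC.inducedRegret ν P B T ≤
              c * (K ^ 3 * EBTC.maxGap ν / min (EBTC.minGap ν) ε₀ ^ 2 *
                Real.log (K / min (EBTC.minGap ν) ε₀ ^ 2) ^ 2)) := by
  constructor
  · intro K ε₀ hε ν hν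
    obtain ⟨m, hm, hmε, hgap⟩ := EBTC.exists_pos_le_gap ν hε
    exact ⟨_, fun P _ ℱ I X B C h => h.inducedRegret_le hβ hν hm hmε hgap⟩
  · intro κ hκ
    have hlog : 0 < Real.log κ := Real.log_pos hκ
    have hγ : 0 < min β (1 - β) := lt_min hβ.1 (sub_pos.2 hβ.2)
    refine ⟨(16910 / Real.log κ ^ 2 + 256 / Real.log κ) / min β (1 - β), by positivity, ?_⟩
    intro K ε₀ hε ν hν hsub hκν Ω mΩ P _ ℱ I X B C h T
    exact h.inducedRegret_le_log_sq hβ hν (lt_min (EBTC.minGap_pos hsub) hε) (min_le_right _ _)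
      (fun i hi => (min_le_left _ _).trans (EBTC.minGap_le hi)) hκ hκν T

theorem mainTheorem6 :
    -- the regret is bounded by a constant independent of the horizon, on every instance
    (∀ (K : ℕ), 2 ≤ K → ∀ (ε₀ : ℝ), 0 < ε₀ →
      ∀ (ν : Fin K → MeasureTheory.Measure ℝ),
        (∀ i, MeasureTheory.IsProbabilityMeasure (ν i)) → (∀ i, EBTC.IsOneSubGaussian (ν i)) →
      ∃ R : ℝ,
        ∀ {Ω : Type*} {mΩ : MeasurableSpace Ω} (P : MeasureTheory.Measure Ω)
          (_ : MeasureTheory.IsProbabilityMeasure P) (ℱ : MeasureTheory.Filtration ℕ mΩ)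
          (I : ℕ → Ω → Fin K) (X : ℕ → Ω → ℝ) (B C : ℕ → Ω → Fin K),
          EBTC.IsEBTCRun ε₀ (1 / 2) ν P ℱ I X B C →
          ∀ T : ℕ, K < T → EBTC.inducedRegret ν P B T ≤ R) ∧
    -- the order of magnitude of the constant
    (∀ κ : ℝ, 1 < κ → ∃ c : ℝ, 0 < c ∧
      ∀ (K : ℕ), 2 ≤ K → ∀ (ε₀ : ℝ), 0 < ε₀ →
      ∀ (ν : Fin K → MeasureTheory.Measure ℝ),
        (∀ i, MeasureTheory.IsProbabilityMeasure (ν i)) → (∀ i, EBTC.IsOneSubGaussian (ν i)) →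
        (∃ i, 0 < EBTC.gap ν i) →
        κ ≤ (K : ℝ) / (min (EBTC.minGap ν) ε₀) ^ 2 →
        ∀ {Ω : Type*} {mΩ : MeasurableSpace Ω} (P : MeasureTheory.Measure Ω)
          (_ : MeasureTheory.IsProbabilityMeasure P) (ℱ : MeasureTheory.Filtration ℕ mΩ)
          (I : ℕ → Ω → Fin K) (X : ℕ → Ω → ℝ) (B C : ℕ → Ω → Fin K),
          EBTC.IsEBTCRun ε₀ (1 / 2) ν P ℱ I X B C →
          ∀ T : ℕ, K < T →
            EBTC.inducedRegret ν P B T ≤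
              c * ((K : ℝ) ^ 3 * EBTC.maxGap ν / (min (EBTC.minGap ν) ε₀) ^ 2 *
                (Real.log ((K : ℝ) / (min (EBTC.minGap ν) ε₀) ^ 2)) ^ 2)) := by
  obtain ⟨bounded, rate⟩ := mainTheorem6_general (β := 1 / 2) (by norm_num)
  refine ⟨fun K _ ε₀ hε ν _ hν => (bounded K ε₀ hε ν hν).imp
      fun R hR _ _ P _ ℱ I X B C h T _ => hR P ℱ I X B C h T,
    fun κ hκ => (rate κ hκ).imp fun c ⟨hc, hrate⟩ => ⟨hc,
      fun K _ ε₀ hε ν _ hν hsub hκν _ _ P _ ℱ I X B C h T _ =>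
        hrate K ε₀ hε ν hν hsub hκν P ℱ I X B C h T⟩⟩
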